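/- Let $E$ be an elliptic curve over $\mathbb{Q}$ and let $p$ be a prime at which $E$ has good ordinary reduction; that is, $E$ has good reduction at $p$ and $p\nmid a_p$, where $a_p=p+1-\#E(\mathbb{F}_p)$. Let $\theta\in[0,\pi]$ be the Frobenius angle of $E$ at $p$, that is, the angle such that the roots of $T^2-a_pT+p$ are $\sqrt p\,e^{i\theta}$ and $\sqrt p\,e^{-i\theta}$. Let $J_0(z)=\sum_{m\ge 0}\frac{(-1)^m}{(m!)^2}\left(\frac z2\right)^{2m}$ be the Bessel function of the first kind of order $0$. Then for every integer $k\neq 0$, as the real number $x\to\infty$, $$\sum_{1\le n\le x}e^{-2\pi i k\cos(n\theta)}=J_0(2\pi k)\,x+o(x).$$ -/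

import Mathlib

open Polynomial

noncomputable section

namespace FrobeniusAngle

/-- The Bessel function of the first kind of order zero,
`J₀(z) = ∑_{m ≥ 0} (-1)^m / (m!)^2 * (z / 2)^(2m)`. -/
def besselJZero (z : ℂ) : ℂ :=
  ∑' m : ℕ, (-1) ^ m / (m.factorial : ℂ) ^ 2 * (z / 2) ^ (2 * m)

/-- The series defining `J₀` converges absolutely at every point. -/
theorem summable_besselJZero (z : ℂ) :
    Summable fun m : ℕ => (-1) ^ m / (m.factorial : ℂ) ^ 2 * (z / 2) ^ (2 * m) := by
  refine Summable.of_norm_bounded (Real.summable_pow_div_factorial (‖z / 2‖ ^ 2)) fun m => ?_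
  have h1 : (1 : ℝ) ≤ m.factorial := by exact_mod_cast Nat.factorial_pos m
  rw [norm_mul, norm_div, norm_pow, norm_pow, norm_pow, norm_neg, norm_one, one_pow,
    Complex.norm_natCast, ← pow_mul, div_mul_eq_mul_div, one_mul]
  gcongr
  nlinarith

/-- A minimal Weierstrass equation at `p` (over the `p`-adic integers) of a curve over `ℚ`. -/
def minimalAt (E : WeierstrassCurve ℚ) (p : ℕ) [Fact p.Prime] : WeierstrassCurve ℚ_[p] :=
  (E.baseChange ℚ_[p]).minimal ℤ_[p]

instance (E : WeierstrassCurve ℚ) (p : ℕ) [Fact p.Prime] :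
    WeierstrassCurve.IsMinimal ℤ_[p] (minimalAt E p) :=
  inferInstanceAs (WeierstrassCurve.IsMinimal ℤ_[p] ((E.baseChange ℚ_[p]).minimal ℤ_[p]))

/-- `p` is a prime of good reduction of `E`. -/
def HasGoodReductionAt (E : WeierstrassCurve ℚ) (p : ℕ) [Fact p.Prime] : Prop :=
  (minimalAt E p).HasGoodReduction ℤ_[p]

/-- The reduction of `E` modulo `p`, a curve over the residue field `ℤ_p / pℤ_p = 𝔽_p`. -/
def reductionAt (E : WeierstrassCurve ℚ) (p : ℕ) [Fact p.Prime] :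
    WeierstrassCurve (IsLocalRing.ResidueField ℤ_[p]) :=
  (minimalAt E p).reduction ℤ_[p]

/-- The trace of Frobenius `a_p = p + 1 - #E(𝔽_p)`; the point at infinity is counted. -/
def frobeniusTrace (E : WeierstrassCurve ℚ) (p : ℕ) [Fact p.Prime] : ℤ :=
  p + 1 - Nat.card (reductionAt E p).toAffine.Point

/-- `E` has good ordinary reduction at `p`: good reduction, and `p ∤ a_p`. -/
def IsOrdinaryAt (E : WeierstrassCurve ℚ) (p : ℕ) [Fact p.Prime] : Prop :=
  HasGoodReductionAt E p ∧ ¬ (p : ℤ) ∣ frobeniusTrace E p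

/-- `θ ∈ [0, π]` is the Frobenius angle of `E` at `p`: the two roots, with multiplicity, of the
characteristic polynomial `T^2 - a_p T + p` of Frobenius are `√p e^{iθ}` and `√p e^{-iθ}`. -/
def IsFrobeniusAngle (E : WeierstrassCurve ℚ) (p : ℕ) [Fact p.Prime] (θ : ℝ) : Prop :=
  θ ∈ Set.Icc 0 Real.pi ∧
    (X ^ 2 - C (frobeniusTrace E p : ℂ) * X + C (p : ℂ) : ℂ[X]).roots =
      {(Real.sqrt p : ℂ) * Complex.exp (θ * Complex.I),
        (Real.sqrt p : ℂ) * Complex.exp (-θ * Complex.I)}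

end FrobeniusAngle

end

/-!
Ordinarity makes `θ` an irrational multiple of `π`: otherwise `2 cos θ = a_p / √p` would be an
algebraic integer, so that the rational number `a_p² / p` would be an integer. By Weyl's theorem
the multiples `nθ` are then equidistributed modulo `2π`, and averaging `e^{-iz cos t}` along them
gives its mean `(2π)⁻¹ ∫₀^{2π} e^{-iz cos t} dt`, which is `J₀(z)`.
-/

open Filter MeasureTheory Topology

namespace FrobeniusAngle

section Equidistribution

theorem norm_sum_Icc_div_le {E : Type*} [SeminormedAddCommGroup E] {v : ℕ → E} {C : ℝ}
    (hv : ∀ n, ‖v n‖ ≤ C) (N : ℕ) :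
    ‖∑ n ∈ Finset.Icc 1 N, v n‖ / N ≤ C := by
  have hC : 0 ≤ C := (norm_nonneg _).trans (hv 0)
  refine div_le_of_le_mul₀ N.cast_nonneg hC ((norm_sum_le_of_le _ fun n _ => hv n).trans_eq ?_)
  simp [mul_comm]

theorem lipschitzWith_average {X : Type*} [TopologicalSpace X] [CompactSpace X] (u : ℕ → X)
    (N : ℕ) :
    LipschitzWith 1 fun f : C(X, ℂ) => (∑ n ∈ Finset.Icc 1 N, f (u n)) / (N : ℂ) := by
  refine LipschitzWith.of_dist_le_mul fun f g => ?_
  rw [NNReal.coe_one, one_mul, dist_eq_norm, dist_eq_norm, ← sub_div, ← Finset.sum_sub_distrib,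
    norm_div, Complex.norm_natCast]
  exact norm_sum_Icc_div_le (fun n => (f - g).norm_coe_le_norm (u n)) N

variable {X : Type*} [TopologicalSpace X] [MeasurableSpace X]

/-- Equidistribution of the sequence `u 1, u 2, …` with respect to `μ`, tested against continuous
complex-valued functions; the term `u 0` is ignored. -/
def Equidistributed (u : ℕ → X) (μ : Measure X) : Prop :=
  ∀ f : C(X, ℂ), Tendsto (fun N : ℕ => (∑ n ∈ Finset.Icc 1 N, f (u n)) / N) atTop
    (𝓝 (∫ x, f x ∂μ))

theorem continuous_integral_continuousMap [CompactSpace X] [BorelSpace X] (μ : Measure X)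
    [IsFiniteMeasure μ] : Continuous fun f : C(X, ℂ) => ∫ x, f x ∂μ := by
  have h := continuous_integral.comp (ContinuousMap.toLp (E := ℂ) 1 μ ℂ).continuous
  refine h.congr fun f => ?_
  exact integral_congr_ae (ContinuousMap.coeFn_toLp μ f)

theorem equidistributed_of_span_dense [CompactSpace X] [BorelSpace X] {μ : Measure X}
    [IsFiniteMeasure μ] {u : ℕ → X} {S : Set C(X, ℂ)}
    (hS : (Submodule.span ℂ S).topologicalClosure = ⊤)
    (hu : ∀ f ∈ S, Tendsto (fun N : ℕ => (∑ n ∈ Finset.Icc 1 N, f (u n)) / (N : ℂ)) atTop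
      (𝓝 (∫ x, f x ∂μ))) :
    Equidistributed u μ := by
  have integrable (f : C(X, ℂ)) : Integrable f μ :=
    f.continuous.integrable_of_hasCompactSupport (HasCompactSupport.of_compactSpace f)
  have on_span (f : C(X, ℂ)) (hf : f ∈ Submodule.span ℂ S) :
      Tendsto (fun N : ℕ => (∑ n ∈ Finset.Icc 1 N, f (u n)) / (N : ℂ)) atTop
        (𝓝 (∫ x, f x ∂μ)) := by
    induction hf using Submodule.span_induction with
    | mem f hf => exact hu f hf
    | zero => simp
    | add f g _ _ hf hg =>
      simpa [Finset.sum_add_distrib, add_div, integral_add (integrable f) (integrable g)]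
        using hf.add hg
    | smul c f _ hf => simpa [← Finset.mul_sum, mul_div_assoc, integral_const_mul]
        using hf.const_mul c
  have closed := (LipschitzWith.uniformEquicontinuous _ 1
    (lipschitzWith_average u)).equicontinuous.isClosed_setOfPred_tendsto (l := atTop)
      (continuous_integral_continuousMap μ)
  intro f
  refine closure_minimal on_span closed ?_
  rw [← Submodule.topologicalClosure_coe, hS]
  trivial

theorem tendsto_average_pow_of_norm_eq_one {w : ℂ} (hw : ‖w‖ = 1) (hw1 : w ≠ 1) :
    Tendsto (fun N : ℕ => (∑ n ∈ Finset.Icc 1 N, w ^ n) / (N : ℂ)) atTop (𝓝 0) := by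
  refine squeeze_zero_norm (fun N => ?_) (tendsto_const_div_atTop_nhds_zero_nat (2 / ‖w - 1‖))
  rw [norm_div, Complex.norm_natCast, ← Finset.Ico_add_one_right_eq_Icc,
    geom_sum_Ico hw1 (by lia), norm_div]
  gcongr
  calc ‖w ^ (N + 1) - w ^ 1‖ ≤ ‖w ^ (N + 1)‖ + ‖w ^ 1‖ := norm_sub_le _ _
    _ = 2 := by simp only [norm_pow, hw, one_pow]; norm_num

variable {T : ℝ} [Fact (0 < T)]

theorem equidistributed_nsmul_addCircle {a : AddCircle T} (ha : ¬ IsOfFinAddOrder a) :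
    Equidistributed (fun n => n • a) AddCircle.haarAddCircle := by
  refine equidistributed_of_span_dense span_fourier_closure_eq_top ?_
  rintro _ ⟨k, rfl⟩
  have integral_eq : ∫ x, fourier k x ∂(AddCircle.haarAddCircle (T := T)) =
      (Pi.single k 1 : ℤ → ℂ) 0 := by
    rw [← fourierCoeff_fourier (T := T) k]
    simp [fourierCoeff]
  have fourier_nsmul (n : ℕ) : fourier k (n • a) = fourier k a ^ n := by
    rw [fourier_apply, fourier_apply, smul_comm, AddCircle.toCircle_nsmul, Circle.coe_pow]
  simp only [integral_eq, fourier_nsmul]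
  obtain rfl | hk := eq_or_ne k 0
  · refine tendsto_const_nhds.congr' ?_
    filter_upwards [eventually_ne_atTop 0] with N hN
    simp [hN]
  · rw [Pi.single_eq_of_ne hk.symm]
    refine tendsto_average_pow_of_norm_eq_one (Circle.norm_coe _) fun h => ha ?_
    have hka : k • a = 0 := by
      apply AddCircle.injective_toCircle (Fact.out : 0 < T).ne'
      rw [AddCircle.toCircle_zero]
      exact Circle.ext h
    exact isOfFinAddOrder_iff_zsmul_eq_zero.mpr ⟨k, hk, hka⟩

theorem tendsto_average_of_periodic {θ : ℝ} (hθ : Irrational (θ / T)) {f : ℝ → ℂ}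
    (hf : Continuous f) (hfT : f.Periodic T) :
    Tendsto (fun N : ℕ => (∑ n ∈ Finset.Icc 1 N, f (n * θ)) / (N : ℂ)) atTop
      (𝓝 (T⁻¹ • ∫ t in 0..T, f t)) := by
  have ha : ¬ IsOfFinAddOrder (θ : AddCircle T) :=
    AddCircle.not_isOfFinAddOrder_iff_forall_rat_ne_div.mpr fun q hq => hθ ⟨q, hq⟩
  let g : C(AddCircle T, ℂ) := ⟨hfT.lift, hf.quotient_lift _⟩
  have hg (t : ℝ) : g t = f t := hfT.lift_coe t
  have h := equidistributed_nsmul_addCircle ha g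
  rw [AddCircle.integral_haarAddCircle, ← AddCircle.intervalIntegral_preimage T 0, zero_add] at h
  simpa only [← AddCircle.coe_nsmul, hg, nsmul_eq_mul] using h

end Equidistribution

section Bessel

open Real

theorem integral_cos_pow_add_two_zero_two_pi (n : ℕ) :
    ∫ t in 0..2 * π, cos t ^ (n + 2) = (n + 1) / (n + 2) * ∫ t in 0..2 * π, cos t ^ n := by
  simp [integral_cos_pow]

theorem integral_cos_pow_two_mul_zero_two_pi (n : ℕ) :
    ∫ t in 0..2 * π, cos t ^ (2 * n) = 2 * π * n.centralBinom / 4 ^ n := by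
  induction n with
  | zero => simp
  | succ n ih =>
    have hn : ((n + 1 : ℕ) : ℝ) * (n + 1).centralBinom = 2 * (2 * n + 1) * n.centralBinom := by
      exact_mod_cast n.succ_mul_centralBinom_succ
    rw [mul_add_one, integral_cos_pow_add_two_zero_two_pi, ih]
    push_cast at hn ⊢
    field_simp
    linear_combination -4 ^ n * 2 * hn

theorem integral_cos_pow_two_mul_add_one_zero_two_pi (n : ℕ) :
    ∫ t in 0..2 * π, cos t ^ (2 * n + 1) = 0 := by
  induction n with
  | zero => simp
  | succ n ih =>
    rw [mul_add_one, add_right_comm, integral_cos_pow_add_two_zero_two_pi, ih, mul_zero]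

theorem hasSum_integral_exp_mul_cos (w : ℂ) :
    HasSum (fun m : ℕ => w ^ m / m.factorial * ((∫ t in 0..2 * π, cos t ^ m : ℝ) : ℂ))
      (∫ t in 0..2 * π, Complex.exp (w * cos t)) := by
  have hasSum_exp (t : ℝ) : HasSum (fun m : ℕ => w ^ m / m.factorial * ((cos t ^ m : ℝ) : ℂ))
      (Complex.exp (w * cos t)) := by
    rw [Complex.exp_eq_exp_ℂ]
    refine (NormedSpace.expSeries_div_hasSum_exp (w * cos t)).congr_fun fun m => ?_
    push_cast
    ring
  have bound (m : ℕ) (t : ℝ) :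
      ‖w ^ m / m.factorial * ((cos t ^ m : ℝ) : ℂ)‖ ≤ ‖w‖ ^ m / m.factorial := by
    rw [norm_mul, norm_div, norm_pow, Complex.norm_natCast, Complex.norm_real, norm_pow]
    exact mul_le_of_le_one_right (by positivity)
      (pow_le_one₀ (norm_nonneg _) (abs_cos_le_one t))
  have hasSum_integral : HasSum
      (fun m : ℕ => ∫ t in 0..2 * π, w ^ m / m.factorial * ((cos t ^ m : ℝ) : ℂ))
      (∫ t in 0..2 * π, Complex.exp (w * cos t)) := by
    refine intervalIntegral.hasSum_integral_of_dominated_convergence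
      (fun m _ => ‖w‖ ^ m / m.factorial) (fun m => ?_) (fun m => .of_forall fun t _ => bound m t)
      (.of_forall fun _ _ => summable_pow_div_factorial ‖w‖) intervalIntegrable_const
      (.of_forall fun t _ => hasSum_exp t)
    exact Continuous.aestronglyMeasurable (by fun_prop)
  simpa only [intervalIntegral.integral_const_mul, intervalIntegral.integral_ofReal]
    using hasSum_integral

theorem besselJZero_eq_integral (z : ℂ) :
    besselJZero z = (2 * π)⁻¹ • ∫ t in 0..2 * π, Complex.exp (-(Complex.I * z) * cos t) := by
  have two_mul_injective : Function.Injective fun m : ℕ => 2 * m :=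
    mul_right_injective₀ two_ne_zero
  have even_terms := (two_mul_injective.hasSum_iff fun m hm => by
    obtain ⟨r, rfl | rfl⟩ := m.even_or_odd'
    · exact absurd ⟨r, rfl⟩ hm
    · rw [integral_cos_pow_two_mul_add_one_zero_two_pi, Complex.ofReal_zero, mul_zero]).mpr
    (hasSum_integral_exp_mul_cos (-(Complex.I * z)))
  rw [← (even_terms.const_smul (2 * π)⁻¹).tsum_eq, besselJZero]
  refine tsum_congr fun m => ?_
  have hc : (m.centralBinom : ℂ) = (2 * m).factorial / (m.factorial * m.factorial) := by
    rw [Nat.centralBinom_eq_two_mul_choose, Nat.cast_choose ℂ (by lia), two_mul,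
      Nat.add_sub_cancel]
  have hm : (m.factorial : ℂ) ≠ 0 := Nat.cast_ne_zero.mpr m.factorial_ne_zero
  have h2m : ((2 * m).factorial : ℂ) ≠ 0 := Nat.cast_ne_zero.mpr (2 * m).factorial_ne_zero
  have hπ : (π : ℂ) ≠ 0 := Complex.ofReal_ne_zero.mpr pi_ne_zero
  have hpow : (-(Complex.I * z)) ^ (2 * m) = (-1) ^ m * (z / 2) ^ (2 * m) * 4 ^ m := by
    rw [pow_mul, pow_mul, neg_sq, mul_pow, Complex.I_sq, ← mul_pow, ← mul_pow]
    ring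
  simp only [Function.comp_apply, integral_cos_pow_two_mul_zero_two_pi, hpow, Complex.real_smul]
  push_cast [hc]
  field_simp

end Bessel

theorem isLittleO_sum_Icc_floor_sub_mul {u : ℕ → ℂ} {c : ℂ}
    (hu : Tendsto (fun N : ℕ => (∑ n ∈ Finset.Icc 1 N, u n) / (N : ℂ)) atTop (𝓝 c)) :
    (fun x : ℝ => ∑ n ∈ Finset.Icc 1 ⌊x⌋₊, u n - c * x) =o[atTop] fun x : ℝ => x := by
  have floor_div : Tendsto (fun x : ℝ => ((⌊x⌋₊ / x : ℝ) : ℂ)) atTop (𝓝 1) := by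
    exact_mod_cast tendsto_nat_floor_div_atTop (R := ℝ).ofReal
  have sum_div : Tendsto (fun x : ℝ => (∑ n ∈ Finset.Icc 1 ⌊x⌋₊, u n) / (x : ℂ)) atTop (𝓝 c) := by
    rw [← mul_one c]
    refine ((hu.comp tendsto_nat_floor_atTop).mul floor_div).congr' ?_
    filter_upwards [eventually_ge_atTop 1] with x hx
    have hfloor : (⌊x⌋₊ : ℂ) ≠ 0 := Nat.cast_ne_zero.mpr (Nat.floor_pos.mpr hx).ne'
    rw [Function.comp_apply, Complex.ofReal_div, Complex.ofReal_natCast,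
      div_mul_div_cancel₀ hfloor]
  rw [← Complex.isLittleO_ofReal_right, Asymptotics.isLittleO_iff_tendsto'
    ((eventually_ne_atTop 0).mono fun x hx h => absurd (Complex.ofReal_eq_zero.mp h) hx),
    ← sub_self c]
  refine (sum_div.sub_const c).congr' ?_
  filter_upwards [eventually_ne_atTop 0] with x hx
  rw [sub_div, mul_div_cancel_right₀ _ (Complex.ofReal_ne_zero.mpr hx)]

theorem irrational_div_pi_of_two_mul_sqrt_mul_cos_eq {n : ℕ} {a : ℤ} (hn : ¬ (n : ℤ) ∣ a ^ 2)
    {θ : ℝ} (h : 2 * √n * Real.cos θ = a) : Irrational (θ / Real.pi) := by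
  rintro ⟨q, hq⟩
  have hθ : θ = q * Real.pi := (eq_div_iff Real.pi_ne_zero).mp hq |>.symm
  have hsq : (n : ℝ) * (2 * Real.cos θ) ^ 2 = a ^ 2 := by
    rw [← h, mul_pow, mul_pow, mul_pow, Real.sq_sqrt n.cast_nonneg]
    ring
  have hn0 : n ≠ 0 := by
    rintro rfl
    rw [Nat.cast_zero, zero_mul] at hsq
    exact hn ⟨0, by exact_mod_cast hsq.symm⟩
  have integral : IsIntegral ℤ ((2 * Real.cos θ) ^ 2) :=
    (hθ ▸ Real.isIntegral_two_mul_cos_rat_mul_pi q).pow 2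
  have rational : (2 * Real.cos θ) ^ 2 = ((a ^ 2 / n : ℚ) : ℝ) := by
    push_cast
    rw [← hsq, mul_div_cancel_left₀ _ (Nat.cast_ne_zero.mpr hn0)]
  obtain ⟨b, hb⟩ := (IsIntegral.exists_int_iff_exists_rat integral).mp ⟨_, rational⟩
  refine hn ⟨b, ?_⟩
  rw [hb] at hsq
  exact_mod_cast hsq.symm

section FrobeniusTrace

variable {E : WeierstrassCurve ℚ} {p : ℕ} [Fact p.Prime] {θ : ℝ}

theorem IsFrobeniusAngle.two_mul_sqrt_mul_cos_eq (hθ : IsFrobeniusAngle E p θ) :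
    2 * √p * Real.cos θ = frobeniusTrace E p := by
  have hroots : (C 1 * X ^ 2 + C (-frobeniusTrace E p : ℂ) * X + C (p : ℂ) : ℂ[X]).roots =
      {(√p : ℂ) * Complex.exp (θ * Complex.I), (√p : ℂ) * Complex.exp (-θ * Complex.I)} := by
    rw [← hθ.2, C_1, one_mul, C_neg, neg_mul, ← sub_eq_add_neg]
  have vieta := eq_neg_mul_add_of_roots_quadratic_eq_pair hroots
  have trace_eq : (2 * √p * Complex.cos θ : ℂ) = frobeniusTrace E p := by
    linear_combination vieta + √p * Complex.two_cos θ
  exact_mod_cast trace_eq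

theorem IsFrobeniusAngle.irrational_div_pi (hθ : IsFrobeniusAngle E p θ)
    (hp : ¬ (p : ℤ) ∣ frobeniusTrace E p) : Irrational (θ / Real.pi) :=
  irrational_div_pi_of_two_mul_sqrt_mul_cos_eq
    (fun h => hp ((Nat.prime_iff_prime_int.mp Fact.out).dvd_of_dvd_pow h))
    hθ.two_mul_sqrt_mul_cos_eq

end FrobeniusTrace

end FrobeniusAngle

theorem corollary3p1_general {θ : ℝ} (hθ : Irrational (θ / Real.pi)) (z : ℂ) :
    (fun x : ℝ =>
        (∑ n ∈ Finset.Icc 1 ⌊x⌋₊, Complex.exp (-(Complex.I * z) * Real.cos (n * θ))) -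
        FrobeniusAngle.besselJZero z * x)
      =o[atTop] (fun x : ℝ => x) := by
  have : Fact (0 < 2 * Real.pi) := ⟨Real.two_pi_pos⟩
  apply FrobeniusAngle.isLittleO_sum_Icc_floor_sub_mul
  rw [FrobeniusAngle.besselJZero_eq_integral]
  refine FrobeniusAngle.tendsto_average_of_periodic
    (f := fun t => Complex.exp (-(Complex.I * z) * Real.cos t)) ?_ (by fun_prop) fun t => ?_
  · rw [div_mul_eq_div_div_swap]
    exact hθ.div_natCast two_ne_zero
  · simp only [Real.cos_add_two_pi]

theorem corollary3p1 (E : WeierstrassCurve ℚ) [E.IsElliptic] (p : ℕ) [Fact p.Prime]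
    (hord : FrobeniusAngle.IsOrdinaryAt E p) (θ : ℝ)
    (hθ : FrobeniusAngle.IsFrobeniusAngle E p θ) (k : ℤ) (hk : k ≠ 0) :
    (fun x : ℝ =>
        (∑ n ∈ Finset.Icc 1 ⌊x⌋₊,
          Complex.exp (-(2 * Real.pi * Complex.I * k * Real.cos (n * θ)))) -
        FrobeniusAngle.besselJZero (2 * Real.pi * k) * x)
      =o[Filter.atTop] (fun x : ℝ => x) := by
  convert corollary3p1_general (hθ.irrational_div_pi hord.2) (2 * Real.pi * k) using 5
  ring_nf
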